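/- Let $D$ be an infinite set of data values and $A$ a nonempty finite alphabet; data words are the finite words over $D\times A$ (for $A$ a singleton: words over $D$). The group $G_D$ of permutations of $D$ acts on letters by $\pi\cdot(d,a)=(\pi(d),a)$. A finite memory automaton (FMA) is a tuple $(\Sigma,Q,I,F,T)$ where the alphabet $\Sigma$ and the configuration space $Q$ are orbit-finite $G_D$-sets (finitely many orbits, and every element is supported by a finite subset of $D$) and $I,F\subseteq Q$ and $T\subseteq Q\times\Sigma\times Q$ are $G_D$-invariant; it recognizes the set of words that label some run from $I$ to $F$. It is deterministic if $I$ is a singleton and $(p,c,q),(p,c,q')\in T$ implies $q=q'$. Semi-rigidly guarded $\mathrm{MSO}^{\sim}$ over data words is generated by $$\varphi ::= \exists x\,\varphi \mid \exists Y\,\varphi \mid a(x)\mid x<y\mid x\in Y\mid \neg\varphi\mid \varphi\wedge\varphi\mid \alpha(x,y)\wedge\beta(x,z)\wedge y\sim z ,$$ where $a\in A$, $y\sim z$ says that positions $y$ and $z$ carry the same data value, and $\alpha(x,y)$, $\beta(x,z)$ are formulas of the same logic, with no free variables other than those displayed, that are semi-rigid: in every data word over $D\times A$ and for every position $x$ there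 is at most one position $y$ (resp. $z$) satisfying $\alpha(x,y)$ (resp. $\beta(x,z)$). Let $L_{\curvearrowright^*}$ be the set of data words $(d_1,a_1)\cdots(d_n,a_n)$ for which there are $\ell\ge 0$ and $0=i_0<i_1<\dots<i_\ell=n$ such that, for all $0\le j<\ell$: $i_{j+1}\ge i_j+2$, $d_{i_j+1}=d_{i_{j+1}}$, and $d_k\ne d_{i_j+1}$ whenever $i_j+1<k<i_{j+1}$. Then $L_{\curvearrowright^*}$ is recognized by a deterministic FMA over $\Sigma=D\times A$, but no sentence of semi-rigidly guarded $\mathrm{MSO}^{\sim}$ defines it. -/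

import Mathlib

namespace DataLogic

universe u v w

/-- A letter of a data word over `D × A`: a data value together with a symbol of `A`. -/
@[ext]
structure Letter (D : Type u) (A : Type v) where
  data : D
  label : A

/-- Renamings (permutations of `D`) act on the data component of a letter. -/
instance (D : Type u) (A : Type v) : MulAction (Equiv.Perm D) (Letter D A) where
  smul π c := ⟨π c.data, c.label⟩
  one_smul _ := rfl
  mul_smul _ _ _ := rfl

/-! ### Finite memory automata -/

/-- An orbit-finite `G_D`-set: every element has finite memory (is supported by a finite set of
data values), and there are finitely many orbits under the renamings. -/
structure OrbitFinite (D : Type u) (X : Type w) [MulAction (Equiv.Perm D) X] : Prop where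
  finite_memory : ∀ x : X, ∃ C : Finset D, MulAction.Supports (Equiv.Perm D) (C : Set D) x
  finite_orbits : Finite (MulAction.orbitRel.Quotient (Equiv.Perm D) X)

/-- A finite memory automaton over the input alphabet `S`. -/
structure FMA (D : Type u) (S : Type v) [MulAction (Equiv.Perm D) S] where
  /-- the configuration space -/
  Q : Type u
  [action : MulAction (Equiv.Perm D) Q]
  /-- the initial configurations -/
  I : Set Q
  /-- the final configurations -/
  F : Set Q
  /-- the transitions -/
  T : Set (Q × S × Q)
  alphabet_orbitFinite : OrbitFinite D S
  config_orbitFinite : OrbitFinite D Q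
  I_equivariant : ∀ (π : Equiv.Perm D) (q : Q), q ∈ I → π • q ∈ I
  F_equivariant : ∀ (π : Equiv.Perm D) (q : Q), q ∈ F → π • q ∈ F
  T_equivariant : ∀ (π : Equiv.Perm D) (p : Q) (c : S) (q : Q),
    (p, c, q) ∈ T → (π • p, π • c, π • q) ∈ T

attribute [instance] FMA.action

namespace FMA

variable {D : Type u} {S : Type v} [MulAction (Equiv.Perm D) S]

/-- There is a run of the automaton from `p` to `q` on the given word. -/
def HasRun (M : FMA D S) : M.Q → List S → M.Q → Prop
  | p, [], q => p = q
  | p, c :: w, q => ∃ r, (p, c, r) ∈ M.T ∧ M.HasRun r w q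

/-- The recognized language. -/
def language (M : FMA D S) : Set (List S) :=
  {w | ∃ p ∈ M.I, ∃ q ∈ M.F, M.HasRun p w q}

/-- Determinism: exactly one initial configuration, and a functional transition relation. -/
def IsDeterministic (M : FMA D S) : Prop :=
  (∃ q₀, M.I = {q₀}) ∧
    ∀ (p : M.Q) (c : S) (q q' : M.Q), (p, c, q) ∈ M.T → (p, c, q') ∈ M.T → q = q'

end FMA

/-! ### Monadic second-order logic with guarded data tests -/

/-- Formulas with `m` free first-order variables and `n` free monadic second-order variables.
Quantifiers bind the variable of index `0`, all other indices being shifted by one.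
`test α β x y z` is the guarded data test `α(x,y) ∧ β(x,z) ∧ y ∼ z`; the guards have no free
variables besides the two first-order ones (index `0` for `x`, index `1` for `y` or `z`).
Equality of positions is expressible through `<`. -/
inductive Formula (A : Type v) : ℕ → ℕ → Type v
  | label {m n : ℕ} (a : A) (x : Fin m) : Formula A m n
  | lt {m n : ℕ} (x y : Fin m) : Formula A m n
  | mem {m n : ℕ} (x : Fin m) (Y : Fin n) : Formula A m n
  | neg {m n : ℕ} (φ : Formula A m n) : Formula A m n
  | and {m n : ℕ} (φ ψ : Formula A m n) : Formula A m n
  | exFO {m n : ℕ} (φ : Formula A (m + 1) n) : Formula A m n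
  | exSO {m n : ℕ} (φ : Formula A m (n + 1)) : Formula A m n
  | test {m n : ℕ} (α β : Formula A 2 0) (x y z : Fin m) : Formula A m n

namespace Formula

variable {A : Type v}

/-- Truth of a formula on the data word `w`, where first-order variables denote positions of `w`
and monadic second-order variables denote sets of positions. -/
def Sat {D : Type u} (w : List (Letter D A)) :
    {m n : ℕ} → Formula A m n → (Fin m → Fin w.length) → (Fin n → Set (Fin w.length)) → Prop
  | _, _, label a x, ρ, _ => (w.get (ρ x)).label = a
  | _, _, lt x y, ρ, _ => ρ x < ρ y
  | _, _, mem x Y, ρ, σ => ρ x ∈ σ Y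
  | _, _, neg φ, ρ, σ => ¬ φ.Sat w ρ σ
  | _, _, and φ ψ, ρ, σ => φ.Sat w ρ σ ∧ ψ.Sat w ρ σ
  | _, _, exFO φ, ρ, σ => ∃ p : Fin w.length, φ.Sat w (Fin.cons p ρ) σ
  | _, _, exSO φ, ρ, σ => ∃ P : Set (Fin w.length), φ.Sat w ρ (Fin.cons P σ)
  | _, _, test α β x y z, ρ, _ =>
      α.Sat w ![ρ x, ρ y] ![] ∧ β.Sat w ![ρ x, ρ z] ![] ∧
        (w.get (ρ y)).data = (w.get (ρ z)).data

/-- A formula `α(x,y)` is semi-rigid over the class of all data words over `D × A` if, in every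
data word, every position `x` determines at most one position `y` satisfying it. -/
def SemiRigid (D : Type u) (α : Formula A 2 0) : Prop :=
  ∀ (w : List (Letter D A)) (p q q' : Fin w.length),
    α.Sat w ![p, q] ![] → α.Sat w ![p, q'] ![] → q = q'

/-- The formula belongs to semi-rigidly guarded `MSO∼`: all guards of its data tests, at every
nesting depth, are semi-rigid. -/
def SemiRigidlyGuarded (D : Type u) : {m n : ℕ} → Formula A m n → Prop
  | _, _, label _ _ => True
  | _, _, lt _ _ => True
  | _, _, mem _ _ => True
  | _, _, neg φ => φ.SemiRigidlyGuarded D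
  | _, _, and φ ψ => φ.SemiRigidlyGuarded D ∧ ψ.SemiRigidlyGuarded D
  | _, _, exFO φ => φ.SemiRigidlyGuarded D
  | _, _, exSO φ => φ.SemiRigidlyGuarded D
  | _, _, test α β _ _ _ =>
      (α.SemiRigidlyGuarded D ∧ α.SemiRigid D) ∧ (β.SemiRigidlyGuarded D ∧ β.SemiRigid D)

end Formula

/-- The data language `L` is defined by some sentence of semi-rigidly guarded `MSO∼`. -/
def DefinableSemiRigid {D : Type u} {A : Type v} (L : Set (List (Letter D A))) : Prop :=
  ∃ ψ : Formula A 0 0, ψ.SemiRigidlyGuarded D ∧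
    ∀ w : List (Letter D A), w ∈ L ↔ ψ.Sat w ![] ![]

/-! ### The separating language -/

/-- A single arc: a word of length at least two whose first and last data values agree and whose
inner data values are all different from that value. -/
def IsArc {D : Type u} {A : Type v} (b : List (Letter D A)) : Prop :=
  ∃ (c : Letter D A) (s : List (Letter D A)) (c' : Letter D A),
    b = c :: (s ++ [c']) ∧ c'.data = c.data ∧ ∀ e ∈ s, e.data ≠ c.data

/-- The finite (possibly empty) concatenations of arcs. -/
def arcLanguage (D : Type u) (A : Type v) : Set (List (Letter D A)) :=
  {w | ∃ bs : List (List (Letter D A)), (∀ b ∈ bs, IsArc b) ∧ w = bs.flatten}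

end DataLogic

/-! The automaton only has to remember the value of the open arc, if any.

For undefinability, the point is that semi-rigid guards compare few pairs. A guard pair and a
position `x` determine at most one pair `(y,z)`, so a formula compares only linearly many pairs of
positions (`card_compares_le`), whereas a long word has quadratically many. Comparisons are
stratified by the depth of the guards: which pairs are compared at level `j+1` depends only on the
outcomes at level `j` (`compares_succ_congr`).

Start with a word of pairwise distinct values. At each level, close one arc at each end of the
interval of still unique values, joining only pairs not compared at that level (`Stage.step`). The
outcomes there are unchanged, so the next level's comparisons stay the same. The new end points are
chosen to be compared with few positions at the next level, which lets the construction go on. After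
as many rounds as the test depth, the middle still has an arc that never closes, so the word is
outside the language. Two further uncompared joins close everything (`Stage.close`), and the
sentence cannot see the difference. -/

namespace DataLogic

universe u v

/-! ### The deterministic automaton -/

open Classical in
/-- The transition function: `none` means that an arc is about to start, `some d` that an arc with
first value `d` is being read. -/
noncomputable def arcStep {D : Type u} : Option D → D → Option D
  | none, d => some d
  | some e, d => if d = e then none else some e

section Automaton

variable {D : Type u} {A : Type v}

theorem arcStep_smul (π : Equiv.Perm D) (s : Option D) (d : D) :
    arcStep (π • s) (π • d) = π • arcStep s d := by
  cases s with
  | none => rfl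
  | some e =>
    by_cases h : d = e <;> simp [arcStep, h]

theorem foldl_arcStep_some {d : D} {ds : List D} (h : ∀ e ∈ ds, e ≠ d) :
    ds.foldl arcStep (some d) = some d := by
  induction ds with
  | nil => rfl
  | cons e ds ih =>
    have he : e ≠ d := h e (by simp)
    simp only [List.foldl_cons, arcStep, if_neg he]
    exact ih fun x hx => h x (by simp [hx])

theorem foldl_arcStep_arc {d : D} {ds : List D} (h : ∀ e ∈ ds, e ≠ d) :
    (d :: (ds ++ [d])).foldl arcStep none = none := by
  rw [List.foldl_cons, List.foldl_append]
  change List.foldl arcStep (List.foldl arcStep (some d) ds) [d] = none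
  rw [foldl_arcStep_some h]
  simp [arcStep]

/-- Both automaton states need a simultaneous induction: in the second clause `c :: s` is the part
already read of an open arc. -/
theorem mem_arcLanguage_of_foldl (w : List (Letter D A)) :
    ((w.map Letter.data).foldl arcStep none = none → w ∈ arcLanguage D A) ∧
    ∀ (c : Letter D A) (s : List (Letter D A)), (∀ e ∈ s, e.data ≠ c.data) →
      (w.map Letter.data).foldl arcStep (some c.data) = none →
        c :: (s ++ w) ∈ arcLanguage D A := by
  induction w with
  | nil => exact ⟨fun _ => ⟨[], by simp, rfl⟩, fun c s _ h => by simp at h⟩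
  | cons e w ih =>
    refine ⟨fun h => ih.2 e [] (by simp) h, fun c s hs h => ?_⟩
    by_cases he : e.data = c.data
    · simp only [List.map_cons, List.foldl_cons, arcStep, if_pos he] at h
      obtain ⟨bs, hbs, hw⟩ := ih.1 h
      refine ⟨(c :: (s ++ [e])) :: bs, ?_, by simp [hw]⟩
      rintro b hb
      rcases List.mem_cons.1 hb with rfl | hb
      · exact ⟨c, s, e, rfl, he, hs⟩
      · exact hbs b hb
    · simp only [List.map_cons, List.foldl_cons, arcStep, if_neg he] at h
      have := ih.2 c (s ++ [e]) (by
        intro x hx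
        rcases List.mem_append.1 hx with hx | hx
        · exact hs x hx
        · rw [List.mem_singleton.1 hx]; exact he) h
      simpa using this

theorem mem_arcLanguage_iff (w : List (Letter D A)) :
    w ∈ arcLanguage D A ↔ (w.map Letter.data).foldl arcStep none = none := by
  refine ⟨?_, (mem_arcLanguage_of_foldl w).1⟩
  rintro ⟨bs, hbs, rfl⟩
  induction bs with
  | nil => rfl
  | cons b bs ih =>
    obtain ⟨c, s, c', rfl, hc, hs⟩ := hbs b (by simp)
    rw [List.flatten_cons, List.map_append, List.foldl_append]
    have : ((c :: (s ++ [c'])).map Letter.data).foldl arcStep none = none := by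
      simpa [hc] using foldl_arcStep_arc (d := c.data) (ds := s.map Letter.data) (by simpa using hs)
    rw [this]
    exact ih fun b hb => hbs b (by simp [hb])

theorem orbitFinite_letter [Finite A] : OrbitFinite D (Letter D A) where
  finite_memory c := by
    refine ⟨{c.data}, fun π h => ?_⟩
    have h' : π • c.data = c.data := h (by simp)
    exact Letter.ext h' rfl
  finite_orbits := by
    rcases isEmpty_or_nonempty D with hD | ⟨⟨d₀⟩⟩
    · have : IsEmpty (Letter D A) := ⟨fun c => hD.false c.data⟩
      infer_instance
    · refine Finite.of_surjective
        (fun a : A => (Quotient.mk _ (⟨d₀, a⟩ : Letter D A) :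
          MulAction.orbitRel.Quotient (Equiv.Perm D) (Letter D A))) fun q => ?_
      classical
      induction q using Quotient.inductionOn with
      | h c =>
        refine ⟨c.label, Quotient.sound ⟨Equiv.swap c.data d₀, Letter.ext ?_ rfl⟩⟩
        exact Equiv.swap_apply_left _ _

theorem orbitFinite_option : OrbitFinite D (Option D) where
  finite_memory s := by
    refine ⟨s.toFinset, fun π h => ?_⟩
    cases s with
    | none => rfl
    | some d =>
      have h' : π • d = d := h (by simp)
      exact congrArg some h'
  finite_orbits := by
    classical
    rcases isEmpty_or_nonempty D with hD | ⟨⟨d₀⟩⟩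
    · infer_instance
    · refine Finite.of_surjective
        (fun b : Bool => (Quotient.mk _ (if b then some d₀ else none) :
          MulAction.orbitRel.Quotient (Equiv.Perm D) (Option D))) fun q => ?_
      induction q using Quotient.inductionOn with
      | h s =>
        cases s with
        | none => exact ⟨false, rfl⟩
        | some d =>
          exact ⟨true, Quotient.sound ⟨Equiv.swap d d₀,
            congrArg some (Equiv.swap_apply_left d d₀)⟩⟩

/-- The deterministic automaton for the arc language. -/
noncomputable def arcFMA (D : Type u) (A : Type v) [Finite A] : FMA D (Letter D A) where
  Q := Option D
  I := {none}
  F := {none}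
  T := {t | t.2.2 = arcStep t.1 t.2.1.data}
  alphabet_orbitFinite := orbitFinite_letter
  config_orbitFinite := orbitFinite_option
  I_equivariant π q hq := by
    rw [Set.mem_singleton_iff] at hq ⊢
    rw [hq]; rfl
  F_equivariant π q hq := by
    rw [Set.mem_singleton_iff] at hq ⊢
    rw [hq]; rfl
  T_equivariant π p c q h := by
    have h' : q = arcStep p c.data := h
    rw [h']
    exact (arcStep_smul π p c.data).symm

theorem arcFMA_hasRun_iff [Finite A] (p q : Option D) (w : List (Letter D A)) :
    (arcFMA D A).HasRun p w q ↔ (w.map Letter.data).foldl arcStep p = q := by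
  induction w generalizing p with
  | nil => exact Iff.rfl
  | cons c w ih =>
    constructor
    · rintro ⟨r, hr, h⟩
      have hr' : r = arcStep p c.data := hr
      subst hr'
      exact (ih _).1 h
    · intro h
      exact ⟨arcStep p c.data, rfl, (ih _).2 h⟩

theorem arcFMA_isDeterministic [Finite A] : (arcFMA D A).IsDeterministic :=
  ⟨⟨none, rfl⟩, fun _ _ _ _ h h' => Eq.trans h (Eq.symm h')⟩

theorem arcFMA_language [Finite A] : (arcFMA D A).language = arcLanguage D A := by
  ext w
  rw [mem_arcLanguage_iff, ← arcFMA_hasRun_iff]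
  constructor
  · rintro ⟨p, hp, q, hq, h⟩
    have hp' : p = none := hp
    have hq' : q = none := hq
    subst hp' hq'
    exact h
  · exact fun h => ⟨none, rfl, none, rfl, h⟩

end Automaton

/-! ### Formulas evaluated over indexed words -/

namespace Formula

variable {A : Type v} {D : Type u}

/-- Truth of a formula on a word presented as a function on positions. -/
def SatOn {N : ℕ} (W : Fin N → Letter D A) :
    {m n : ℕ} → Formula A m n → (Fin m → Fin N) → (Fin n → Set (Fin N)) → Prop
  | _, _, label a x, ρ, _ => (W (ρ x)).label = a
  | _, _, lt x y, ρ, _ => ρ x < ρ y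
  | _, _, mem x Y, ρ, σ => ρ x ∈ σ Y
  | _, _, neg φ, ρ, σ => ¬ φ.SatOn W ρ σ
  | _, _, and φ ψ, ρ, σ => φ.SatOn W ρ σ ∧ ψ.SatOn W ρ σ
  | _, _, exFO φ, ρ, σ => ∃ p : Fin N, φ.SatOn W (Fin.cons p ρ) σ
  | _, _, exSO φ, ρ, σ => ∃ P : Set (Fin N), φ.SatOn W ρ (Fin.cons P σ)
  | _, _, test α β x y z, ρ, _ =>
      α.SatOn W ![ρ x, ρ y] ![] ∧ β.SatOn W ![ρ x, ρ z] ![] ∧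
        (W (ρ y)).data = (W (ρ z)).data

theorem satOn_get (w : List (Letter D A)) {m n : ℕ} (φ : Formula A m n)
    (ρ : Fin m → Fin w.length) (σ : Fin n → Set (Fin w.length)) :
    φ.SatOn w.get ρ σ ↔ φ.Sat w ρ σ := by
  induction φ with
  | label | lt | mem => exact Iff.rfl
  | neg φ ih => exact not_congr (ih ρ σ)
  | and φ ψ ih ih' => exact and_congr (ih ρ σ) (ih' ρ σ)
  | exFO φ ih => exact exists_congr fun p => ih _ _
  | exSO φ ih => exact exists_congr fun p => ih _ _
  | test α β x y z ih ih' => exact and_congr (ih _ _) (and_congr (ih' _ _) Iff.rfl)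

/-- With positions in a fixed `Fin N`, two words of equal length can be compared under the same
assignments, without casts. -/
theorem sat_iff_satOn (w : List (Letter D A)) {N : ℕ} (h : w.length = N)
    (W : Fin N → Letter D A) (hW : ∀ i, W (Fin.cast h i) = w.get i) (ψ : Formula A 0 0) :
    ψ.Sat w ![] ![] ↔ ψ.SatOn W ![] ![] := by
  subst h
  obtain rfl : W = w.get := funext hW
  exact (satOn_get w ψ _ _).symm

theorem SemiRigid.satOn {α : Formula A 2 0} (hα : α.SemiRigid D) {N : ℕ} (W : Fin N → Letter D A)
    {p q q' : Fin N} (h : α.SatOn W ![p, q] ![]) (h' : α.SatOn W ![p, q'] ![]) : q = q' := by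
  obtain ⟨w, hw, hW⟩ : ∃ (w : List (Letter D A)) (h : w.length = N),
      ∀ i, W (Fin.cast h i) = w.get i := ⟨List.ofFn W, List.length_ofFn, fun i => by simp; rfl⟩
  subst hw
  obtain rfl : W = w.get := funext hW
  exact hα w p q q' ((satOn_get w α _ _).1 h) ((satOn_get w α _ _).1 h')

/-- The nesting depth of data tests. -/
def testDepth : {m n : ℕ} → Formula A m n → ℕ
  | _, _, label _ _ => 0
  | _, _, lt _ _ => 0
  | _, _, mem _ _ => 0
  | _, _, neg φ => φ.testDepth
  | _, _, and φ ψ => max φ.testDepth ψ.testDepth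
  | _, _, exFO φ => φ.testDepth
  | _, _, exSO φ => φ.testDepth
  | _, _, test α β _ _ _ => max α.testDepth β.testDepth + 1

/-- The pairs of guards of all data tests, at every nesting depth. -/
def guards : {m n : ℕ} → Formula A m n → List (Formula A 2 0 × Formula A 2 0)
  | _, _, label _ _ => []
  | _, _, lt _ _ => []
  | _, _, mem _ _ => []
  | _, _, neg φ => φ.guards
  | _, _, and φ ψ => φ.guards ++ ψ.guards
  | _, _, exFO φ => φ.guards
  | _, _, exSO φ => φ.guards
  | _, _, test α β _ _ _ => (α, β) :: (α.guards ++ β.guards)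

theorem SemiRigidlyGuarded.semiRigid {m n : ℕ} {φ : Formula A m n} (h : φ.SemiRigidlyGuarded D) :
    ∀ g ∈ φ.guards, g.1.SemiRigid D ∧ g.2.SemiRigid D := by
  induction φ with
  | label | lt | mem => simp [guards]
  | neg φ ih => exact ih h
  | and φ ψ ih ih' =>
    intro g hg
    rcases List.mem_append.1 hg with hg | hg
    exacts [ih h.1 g hg, ih' h.2 g hg]
  | exFO φ ih => exact ih h
  | exSO φ ih => exact ih h
  | test α β x y z ih ih' =>
    intro g hg
    rcases List.mem_cons.1 hg with rfl | hg
    · exact ⟨h.1.2, h.2.2⟩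
    rcases List.mem_append.1 hg with hg | hg
    exacts [ih h.1.1 g hg, ih' h.2.1 g hg]

theorem guards_trans {m n : ℕ} {φ : Formula A m n} {g g' : Formula A 2 0 × Formula A 2 0}
    (hg : g ∈ φ.guards) (hg' : g' ∈ g.1.guards ∨ g' ∈ g.2.guards) : g' ∈ φ.guards := by
  induction φ with
  | label | lt | mem => simp [guards] at hg
  | neg φ ih => exact ih hg
  | and φ ψ ih ih' =>
    rcases List.mem_append.1 hg with hg | hg
    exacts [List.mem_append_left _ (ih hg), List.mem_append_right _ (ih' hg)]
  | exFO φ ih => exact ih hg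
  | exSO φ ih => exact ih hg
  | test α β x y z ih ih' =>
    refine List.mem_cons_of_mem _ (List.mem_append.2 ?_)
    rcases List.mem_cons.1 hg with rfl | hg
    · exact hg'
    rcases List.mem_append.1 hg with hg | hg
    exacts [Or.inl (ih hg), Or.inr (ih' hg)]

/-- The two positions are compared by some data test of `φ` whose guards have depth below `j`. -/
def Compares {m n : ℕ} (φ : Formula A m n) (j : ℕ) {N : ℕ} (W : Fin N → Letter D A)
    (y z : Fin N) : Prop :=
  ∃ g ∈ φ.guards, g.1.testDepth < j ∧ g.2.testDepth < j ∧
    ∃ x, g.1.SatOn W ![x, y] ![] ∧ g.2.SatOn W ![x, z] ![]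

/-- Words that agree on the labels and on the compared pairs satisfy the same formulas. -/
theorem satOn_congr {N : ℕ} {W W' : Fin N → Letter D A} (hl : ∀ i, (W i).label = (W' i).label)
    {j m n : ℕ} {φ : Formula A m n} (hj : φ.testDepth ≤ j)
    (h : ∀ y z, φ.Compares j W y z → ((W y).data = (W z).data ↔ (W' y).data = (W' z).data))
    (ρ : Fin m → Fin N) (σ : Fin n → Set (Fin N)) : φ.SatOn W ρ σ ↔ φ.SatOn W' ρ σ := by
  induction φ with
  | label a x => simp only [SatOn, hl]
  | lt | mem => exact Iff.rfl
  | neg φ ih => exact not_congr (ih hj h ρ σ)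
  | and φ ψ ih ih' =>
    refine and_congr (ih (le_trans (le_max_left _ _) hj) (fun y z hc => h y z ?_) ρ σ)
      (ih' (le_trans (le_max_right _ _) hj) (fun y z hc => h y z ?_) ρ σ)
    · obtain ⟨g, hg, hc⟩ := hc
      exact ⟨g, List.mem_append_left _ hg, hc⟩
    · obtain ⟨g, hg, hc⟩ := hc
      exact ⟨g, List.mem_append_right _ hg, hc⟩
  | exFO φ ih => exact exists_congr fun p => ih hj h _ _
  | exSO φ ih => exact exists_congr fun p => ih hj h _ _
  | test α β x y z ih ih' =>
    have hj' : max α.testDepth β.testDepth < j := hj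
    rw [max_lt_iff] at hj'
    have hα := ih hj'.1.le (fun y z hc => h y z (by
      obtain ⟨g, hg, hc⟩ := hc
      exact ⟨g, List.mem_cons_of_mem _ (List.mem_append_left _ hg), hc⟩))
    have hβ := ih' hj'.2.le (fun y z hc => h y z (by
      obtain ⟨g, hg, hc⟩ := hc
      exact ⟨g, List.mem_cons_of_mem _ (List.mem_append_right _ hg), hc⟩))
    constructor
    · rintro ⟨h1, h2, h3⟩
      exact ⟨(hα _ _).1 h1, (hβ _ _).1 h2,
        (h _ _ ⟨(α, β), List.mem_cons_self, hj'.1, hj'.2, _, h1, h2⟩).1 h3⟩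
    · rintro ⟨h1, h2, h3⟩
      -- `h` only concerns pairs compared in `W`, so the guards are first carried back from `W'`.
      have h1' := (hα _ _).2 h1
      have h2' := (hβ _ _).2 h2
      exact ⟨h1', h2', (h _ _ ⟨(α, β), List.mem_cons_self, hj'.1, hj'.2, _, h1', h2'⟩).2 h3⟩

/-- Guards used at level `j + 1` have depth at most `j`, and their own tests are among those of `φ`
by `guards_trans`; hence `satOn_congr` applies to them. -/
theorem compares_succ_congr {N : ℕ} {W W' : Fin N → Letter D A}
    (hl : ∀ i, (W i).label = (W' i).label) {j m n : ℕ} {φ : Formula A m n}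
    (h : ∀ y z, φ.Compares j W y z → ((W y).data = (W z).data ↔ (W' y).data = (W' z).data))
    (y z : Fin N) : φ.Compares (j + 1) W y z ↔ φ.Compares (j + 1) W' y z := by
  unfold Compares
  refine exists_congr fun g => and_congr_right fun hg => and_congr_right fun h1 =>
    and_congr_right fun h2 => exists_congr fun x => and_congr ?_ ?_
  · refine satOn_congr hl (Nat.lt_succ_iff.1 h1) (fun y z hc => h y z ?_) _ _
    obtain ⟨g', hg', hc⟩ := hc
    exact ⟨g', guards_trans hg (Or.inl hg'), hc⟩
  · refine satOn_congr hl (Nat.lt_succ_iff.1 h2) (fun y z hc => h y z ?_) _ _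
    obtain ⟨g', hg', hc⟩ := hc
    exact ⟨g', guards_trans hg (Or.inr hg'), hc⟩

open Classical in
/-- Semi-rigid guards compare only linearly many pairs. -/
theorem card_compares_le {m n : ℕ} {φ : Formula A m n} (hφ : φ.SemiRigidlyGuarded D) (j : ℕ)
    {N : ℕ} (W : Fin N → Letter D A) :
    (Finset.univ.filter fun p : Fin N × Fin N => φ.Compares j W p.1 p.2).card ≤
      φ.guards.length * N := by
  let P (t : (Formula A 2 0 × Formula A 2 0) × Fin N) : Finset (Fin N × Fin N) :=
    Finset.univ.filter fun p => t.1.1.SatOn W ![t.2, p.1] ![] ∧ t.1.2.SatOn W ![t.2, p.2] ![]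
  have hsub : (Finset.univ.filter fun p : Fin N × Fin N => φ.Compares j W p.1 p.2) ⊆
      (φ.guards.toFinset ×ˢ Finset.univ).biUnion P := by
    intro p hp
    obtain ⟨g, hg, -, -, x, h⟩ := (Finset.mem_filter.1 hp).2
    exact Finset.mem_biUnion.2 ⟨(g, x), by simp [hg], by simpa [P] using h⟩
  refine (Finset.card_le_card hsub).trans ((Finset.card_biUnion_le_card_mul _ _ 1 ?_).trans ?_)
  · rintro ⟨g, x⟩ hg
    have hg' : g ∈ φ.guards := by simpa using hg
    refine Finset.card_le_one.2 fun p hp q hq => ?_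
    have hp' := (Finset.mem_filter.1 hp).2
    have hq' := (Finset.mem_filter.1 hq).2
    have hr := hφ.semiRigid g hg'
    exact Prod.ext (hr.1.satOn W hp'.1 hq'.1) (hr.2.satOn W hp'.2 hq'.2)
  · rw [mul_one, Finset.card_product, Finset.card_univ, Fintype.card_fin]
    exact Nat.mul_le_mul_right _ (List.toFinset_card_le _)

end Formula

/-! ### Merging values that are never compared -/

section Merging

variable {D : Type u}

/-- The run of the automaton on the positions from `i` (included) to `j` (excluded). -/
noncomputable def arcRun (v : ℕ → D) (s : Option D) (i j : ℕ) : Option D :=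
  ((List.Ico i j).map v).foldl arcStep s

theorem arcRun_arcRun (v : ℕ → D) (s : Option D) {i j k : ℕ} (hij : i ≤ j) (hjk : j ≤ k) :
    arcRun v (arcRun v s i j) j k = arcRun v s i k := by
  unfold arcRun
  rw [← List.foldl_append, ← List.map_append, List.Ico.append_consecutive hij hjk]

theorem arcRun_congr {v v' : ℕ → D} (s : Option D) {i j : ℕ}
    (h : ∀ t, i ≤ t → t < j → v t = v' t) : arcRun v s i j = arcRun v' s i j := by
  unfold arcRun
  rw [List.map_congr_left fun t ht => h t (List.Ico.mem.1 ht).1 (List.Ico.mem.1 ht).2]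

theorem arcRun_succ (v : ℕ → D) (s : Option D) (i : ℕ) :
    arcRun v s i (i + 1) = arcStep s (v i) := by
  simp [arcRun]

theorem arcRun_some (v : ℕ → D) {d : D} {i j : ℕ} (h : ∀ t, i ≤ t → t < j → v t ≠ d) :
    arcRun v (some d) i j = some d := by
  refine foldl_arcStep_some fun e he => ?_
  obtain ⟨t, ht, rfl⟩ := List.mem_map.1 he
  exact h t (List.Ico.mem.1 ht).1 (List.Ico.mem.1 ht).2

theorem arcRun_none (v : ℕ → D) {i j : ℕ} (hij : i < j) (h : ∀ t, i < t → t < j → v t ≠ v i) :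
    arcRun v none i j = some (v i) := by
  rw [← arcRun_arcRun v none (Nat.le_succ i) hij, arcRun_succ]
  exact arcRun_some v fun t ht => h t ht

theorem arcRun_arc (v : ℕ → D) {i j : ℕ} (hij : i < j) (hv : v j = v i)
    (h : ∀ t, i < t → t < j → v t ≠ v i) : arcRun v none i (j + 1) = none := by
  rw [← arcRun_arcRun v none hij.le (Nat.le_succ j), arcRun_none v hij h, arcRun_succ]
  simp [arcStep, hv]

/-- The value at position `p` occurs nowhere else. -/
def UniqueAt (v : ℕ → D) (p : ℕ) : Prop := ∀ q, v q = v p → q = p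

theorem UniqueAt.update {v : ℕ → D} {c l p : ℕ} (hp : UniqueAt v p) (hl : p ≠ l) (hc : p ≠ c) :
    UniqueAt (Function.update v c (v l)) p := by
  intro q hq
  rw [Function.update_of_ne hc] at hq
  by_cases hqc : q = c
  · rw [hqc, Function.update_self] at hq
    exact absurd (hp l hq).symm hl
  · rw [Function.update_of_ne hqc] at hq
    exact hp q hq

/-- Since both values were unique, copying one onto the other position creates a single new equality
and destroys none. -/
theorem update_eq_update_iff {v : ℕ → D} {c l p q : ℕ} (hl : UniqueAt v l) (hc : UniqueAt v c)
    (h : (p, q) ≠ (l, c)) (h' : (p, q) ≠ (c, l)) :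
    v p = v q ↔ Function.update v c (v l) p = Function.update v c (v l) q := by
  by_cases hp : p = c
  · subst hp
    by_cases hq : q = p
    · simp [hq]
    · rw [Function.update_self, Function.update_of_ne hq]
      refine ⟨fun e => absurd (hc q e.symm) hq, fun e => ?_⟩
      exact absurd (by rw [hl q e.symm]) h'
  · by_cases hq : q = c
    · subst hq
      rw [Function.update_self, Function.update_of_ne hp]
      refine ⟨fun e => absurd (hc p e) hp, fun e => ?_⟩
      exact absurd (by rw [hl p e]) h
    · rw [Function.update_of_ne hp, Function.update_of_ne hq]

/-- Give position `c` the value of position `l`, and position `s` the value of position `r`. -/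
def merge (v : ℕ → D) (l c s r : ℕ) : ℕ → D :=
  Function.update (Function.update v c (v l)) s (v r)

section

variable {v : ℕ → D} {l c s r n : ℕ} (hlc : l < c) (hcs : c < s) (hsr : s < r)
  (hv : ∀ p, l ≤ p → p ≤ r → UniqueAt v p)

theorem merge_of_ne {t : ℕ} (hc : t ≠ c) (hs : t ≠ s) : merge v l c s r t = v t := by
  rw [merge, Function.update_of_ne hs, Function.update_of_ne hc]

theorem merge_right : merge v l c s r s = v r := Function.update_self _ _ _

include hcs in
theorem merge_left : merge v l c s r c = v l := by
  rw [merge, Function.update_of_ne hcs.ne, Function.update_self]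

include hcs hsr in
theorem merge_eq : merge v l c s r =
    Function.update (Function.update v c (v l)) s (Function.update v c (v l) r) := by
  rw [Function.update_of_ne (hcs.trans hsr).ne', merge]

include hlc hcs hsr hv in
theorem uniqueAt_merge {p : ℕ} (hp : c < p) (hp' : p < s) : UniqueAt (merge v l c s r) p := by
  rw [merge_eq hcs hsr]
  refine UniqueAt.update (UniqueAt.update (hv p ?_ ?_) ?_ ?_) ?_ ?_ <;> omega

include hlc hcs hsr hv in
theorem merge_eq_merge_iff {E : Finset (ℕ × ℕ)} (hE : ∀ p q, (p, q) ∈ E → (q, p) ∈ E)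
    (hl : (l, c) ∉ E) (hr : (r, s) ∉ E) {p q : ℕ} (hpq : (p, q) ∈ E) :
    v p = v q ↔ merge v l c s r p = merge v l c s r q := by
  rw [merge_eq hcs hsr]
  have h1 : ∀ x y, (x, y) ∉ E → (p, q) ≠ (x, y) := fun x y h e => h (e ▸ hpq)
  have h2 : ∀ x y, (x, y) ∉ E → (y, x) ∉ E := fun x y h e => h (hE _ _ e)
  refine (update_eq_update_iff (hv l ?_ ?_) (hv c ?_ ?_) (h1 _ _ hl) (h1 _ _ (h2 _ _ hl))).trans
    (update_eq_update_iff ((hv r ?_ ?_).update ?_ ?_) ((hv s ?_ ?_).update ?_ ?_)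
      (h1 _ _ hr) (h1 _ _ (h2 _ _ hr))) <;> omega

include hlc hcs hsr hv in
theorem arcRun_merge_left (h0 : arcRun v none 0 l = none) :
    arcRun (merge v l c s r) none 0 (c + 1) = none := by
  rw [← arcRun_arcRun _ _ (Nat.zero_le l) (by omega : l ≤ c + 1),
    arcRun_congr (v' := v) none fun t _ ht => merge_of_ne (by omega) (by omega), h0]
  have hl : merge v l c s r l = v l := merge_of_ne (by omega) (by omega)
  refine arcRun_arc _ hlc ((merge_left hcs).trans hl.symm) fun t ht ht' => ?_
  rw [hl, merge_of_ne (by omega) (by omega)]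
  exact fun e => ht.ne' (hv l le_rfl (by omega) t e)

include hlc hcs hsr hv in
theorem arcRun_merge_right (hrn : r < n) (h0 : arcRun v none (r + 1) n = none) :
    arcRun (merge v l c s r) none s n = none := by
  have hr : merge v l c s r r = v r := merge_of_ne (by omega) (by omega)
  rw [← arcRun_arcRun _ _ (by omega : s ≤ r + 1) hrn, arcRun_arc _ hsr (hr.trans merge_right.symm),
    arcRun_congr (v' := v) none fun t _ ht => merge_of_ne (by omega) (by omega), h0]
  intro t ht ht'
  rw [merge_right, merge_of_ne (by omega) (by omega)]
  exact fun e => ht'.ne (hv r (by omega) le_rfl t e)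

end

/-! ### Selecting the positions to be merged -/

/-- The positions related to `p`. -/
def nbhd (E : Finset (ℕ × ℕ)) (p : ℕ) : Finset ℕ := (E.filter fun e => e.1 = p).image Prod.snd

theorem mem_nbhd {E : Finset (ℕ × ℕ)} {p q : ℕ} : q ∈ nbhd E p ↔ (p, q) ∈ E := by
  simp [nbhd]

/-- The positions related to more than `m` others. -/
def hubs (E : Finset (ℕ × ℕ)) (m : ℕ) : Finset ℕ :=
  (E.image Prod.fst).filter fun p => m < (nbhd E p).card

theorem card_nbhd_le_of_notMem_hubs {E : Finset (ℕ × ℕ)} {m p : ℕ} (h : p ∉ hubs E m) :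
    (nbhd E p).card ≤ m := by
  by_contra! hlt
  refine h (Finset.mem_filter.2 ⟨?_, hlt⟩)
  obtain ⟨q, hq⟩ := Finset.card_pos.1 ((Nat.zero_le m).trans_lt hlt)
  exact Finset.mem_image.2 ⟨_, mem_nbhd.1 hq, rfl⟩

/-- Double counting: distinct hubs are the first components of disjoint sets of pairs. -/
theorem card_hubs_mul_le (E : Finset (ℕ × ℕ)) (m : ℕ) : (hubs E m).card * m ≤ E.card := by
  have h1 : (hubs E m).card * m ≤ ∑ p ∈ hubs E m, (E.filter fun e => e.1 = p).card := by
    rw [← smul_eq_mul]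
    refine Finset.card_nsmul_le_sum _ _ _ fun p hp => ?_
    exact (Finset.mem_filter.1 hp).2.le.trans Finset.card_image_le
  refine h1.trans ?_
  rw [← Finset.card_biUnion]
  · exact Finset.card_le_card (Finset.biUnion_subset.2 fun p _ => Finset.filter_subset _ _)
  · intro p _ q _ hpq
    refine Finset.disjoint_left.2 fun e he he' => hpq ?_
    rw [← (Finset.mem_filter.1 he).2, (Finset.mem_filter.1 he').2]

theorem exists_mem_window (a k : ℕ) (B B' : Finset ℕ) (h : B.card + B'.card < k) :
    ∃ c, a ≤ c ∧ c < a + k ∧ c ∉ B ∧ c ∉ B' := by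
  obtain ⟨c, hc, hc'⟩ := Finset.exists_mem_notMem_of_card_lt_card
    (s := B ∪ B') (t := Finset.Ico a (a + k))
    ((Finset.card_union_le _ _).trans_lt (by simpa using h))
  rw [Finset.mem_Ico] at hc
  rw [Finset.mem_union, not_or] at hc'
  exact ⟨c, hc.1, hc.2, hc'.1, hc'.2⟩

/-- The invariant of the construction: outside the positions from `l` to `r` the word is a
concatenation of arcs, inside them all values are unique, and `l`, `r` are compared with few
positions. -/
structure Stage (E : Finset (ℕ × ℕ)) (m n : ℕ) (v : ℕ → D) (l r : ℕ) : Prop where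
  lt : r < n
  left : arcRun v none 0 l = none
  right : arcRun v none (r + 1) n = none
  unique : ∀ p, l ≤ p → p ≤ r → UniqueAt v p
  card_left : (nbhd E l).card ≤ m
  card_right : (nbhd E r).card ≤ m

/-- `E` is the current level, whose outcomes must survive; `E'` is the next one, for which the new
end points must not be hubs. -/
theorem Stage.step {E E' : Finset (ℕ × ℕ)} {m n l r : ℕ} {v : ℕ → D} (hS : Stage E m n v l r)
    (hE : ∀ p q, (p, q) ∈ E → (q, p) ∈ E) (hE' : (hubs E' m).card < m)
    (hlr : l + 16 * m ≤ r + 1) :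
    ∃ (v' : ℕ → D) (l' r' : ℕ), Stage E' m n v' l' r' ∧ r + 1 + l' ≤ r' + 1 + l + 8 * m ∧
      ∀ p q, (p, q) ∈ E → (v p = v q ↔ v' p = v' q) := by
  -- At most `m` neighbours of `l` and fewer than `m` hubs are forbidden, so `2 * m` candidates
  -- suffice. The new end point is `c + 1`, hence the shift of the hubs.
  obtain ⟨c, hc, hc', hcE, hcH⟩ := exists_mem_window (l + 1) (2 * m) (nbhd E l)
    ((hubs E' m).image fun p => p - 1) (by
      have := Finset.card_image_le (s := hubs E' m) (f := fun p => p - 1)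
      have := hS.card_left
      omega)
  obtain ⟨s, hs, hs', hsE, hsH⟩ := exists_mem_window (r - 2 * m) (2 * m) (nbhd E r)
    ((hubs E' m).image fun p => p + 1) (by
      have := Finset.card_image_le (s := hubs E' m) (f := fun p => p + 1)
      have := hS.card_right
      omega)
  have hlc : l < c := hc
  have hcs : c < s := by omega
  have hsr : s < r := by omega
  refine ⟨merge v l c s r, c + 1, s - 1, ?_, by omega, fun p q hpq => ?_⟩
  · refine ⟨by have := hS.lt; omega, arcRun_merge_left hlc hcs hsr hS.unique hS.left, ?_, ?_, ?_, ?_⟩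
    · rw [Nat.sub_add_cancel (by omega)]
      exact arcRun_merge_right hlc hcs hsr hS.unique hS.lt hS.right
    · exact fun p hp hp' => uniqueAt_merge hlc hcs hsr hS.unique hp (by omega)
    · refine card_nbhd_le_of_notMem_hubs fun h => hcH (Finset.mem_image.2 ⟨_, h, by omega⟩)
    · refine card_nbhd_le_of_notMem_hubs fun h => hsH (Finset.mem_image.2 ⟨_, h, by omega⟩)
  · exact merge_eq_merge_iff hlc hcs hsr hS.unique hE (fun h => hcE (mem_nbhd.2 h))
      (fun h => hsE (mem_nbhd.2 h)) hpq

theorem Stage.close {E : Finset (ℕ × ℕ)} {m n l r : ℕ} {v : ℕ → D} (hS : Stage E m n v l r)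
    (hE : ∀ p q, (p, q) ∈ E → (q, p) ∈ E) (hm : 0 < m) (hlr : l + 16 * m ≤ r + 1) :
    arcRun v none 0 n ≠ none ∧ ∃ v' : ℕ → D, arcRun v' none 0 n = none ∧
      ∀ p q, (p, q) ∈ E → (v p = v q ↔ v' p = v' q) := by
  have hrn := hS.lt
  constructor
  -- The arc opened at `l` never closes, its value being unique.
  · rw [← arcRun_arcRun v none (Nat.zero_le l) (by omega : l ≤ n), hS.left,
      arcRun_none v (by omega) fun t ht _ e => ht.ne' (hS.unique l le_rfl (by omega) t e)]
    exact Option.some_ne_none _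
  -- The two closing arcs run from `l` to `c` and from `c + 1` to `r`, leaving no gap.
  obtain ⟨c, hc, hc', hcE, hcE'⟩ := exists_mem_window (l + 1) (2 * m + 1) (nbhd E l)
    ((nbhd E r).image fun p => p - 1) (by
      have := Finset.card_image_le (s := nbhd E r) (f := fun p => p - 1)
      have := hS.card_left
      have := hS.card_right
      omega)
  have hlc : l < c := hc
  have hsr : c + 1 < r := by omega
  refine ⟨merge v l c (c + 1) r, ?_, fun p q hpq => ?_⟩
  · rw [← arcRun_arcRun _ none (Nat.zero_le (c + 1)) (by omega : c + 1 ≤ n),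
      arcRun_merge_left hlc c.lt_succ_self hsr hS.unique hS.left,
      arcRun_merge_right hlc c.lt_succ_self hsr hS.unique hrn hS.right]
  · exact merge_eq_merge_iff hlc c.lt_succ_self hsr hS.unique hE (fun h => hcE (mem_nbhd.2 h))
      (fun h => hcE' (Finset.mem_image.2 ⟨_, mem_nbhd.2 h, by omega⟩)) hpq

/-- If linearly many pairs are compared at each of `d` levels, and each level depends only on the
outcomes of the preceding comparisons, then some word outside the arc language cannot be told
from some word in it. -/
theorem exists_arcRun_ne_none_and_eq_none [Infinite D] (K d : ℕ) : ∃ n : ℕ,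
    ∀ E : ℕ → (ℕ → D) → Finset (ℕ × ℕ), (∀ v, E 0 v = ∅) →
      (∀ j v p q, (p, q) ∈ E j v → (q, p) ∈ E j v) → (∀ j v, (E j v).card ≤ K * n) →
      (∀ j v v', (∀ p q, (p, q) ∈ E j v → (v p = v q ↔ v' p = v' q)) →
        E (j + 1) v = E (j + 1) v') →
      ∃ v v' : ℕ → D, arcRun v none 0 n ≠ none ∧ arcRun v' none 0 n = none ∧
        ∀ p q, (p, q) ∈ E d v → (v p = v q ↔ v' p = v' q) := by
  -- Each of the `d` steps costs at most `8 * m` positions, and `16 * m` must remain for the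
  -- closing. With `n = C * m` there are at most `K * C < m` hubs.
  obtain ⟨C, hC⟩ : ∃ C, C = 8 * (d + 2) := ⟨_, rfl⟩
  obtain ⟨m, hm⟩ : ∃ m, m = K * C + 1 := ⟨_, rfl⟩
  refine ⟨C * m, fun E hE₀ hsymm hcard hloc => ?_⟩
  have hCm : C * m = 8 * (d * m) + 16 * m := by rw [hC]; ring
  have hhub : ∀ j v, (hubs (E j v) m).card < m := fun j v => by
    have h := (card_hubs_mul_le (E j v) m).trans (hcard j v)
    rw [← mul_assoc] at h
    have := Nat.le_of_mul_le_mul_right h (by omega)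
    omega
  have key : ∀ i ≤ d, ∃ v l r, Stage (E i v) m (C * m) v l r ∧
      l + C * m ≤ r + 1 + 8 * (i * m) := by
    intro i
    induction i with
    | zero =>
      intro _
      refine ⟨Infinite.natEmbedding D, 0, C * m - 1, ⟨by omega, by simp [arcRun], ?_, ?_, ?_, ?_⟩,
        by omega⟩
      · rw [Nat.sub_add_cancel (by omega)]
        simp [arcRun]
      · exact fun p _ _ q h => (Infinite.natEmbedding D).injective h
      · simp [hE₀, nbhd]
      · simp [hE₀, nbhd]
    | succ i ih =>
      intro hi
      obtain ⟨v, l, r, hS, hlr⟩ := ih (by omega)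
      have him : i * m ≤ d * m := Nat.mul_le_mul_right m (by omega)
      obtain ⟨v', l', r', hS', hlr', hv⟩ :=
        hS.step (hsymm i v) (hhub (i + 1) v) (by omega)
      -- The step was made with the next level of the old word `v`; locality identifies it with that
      -- of `v'`.
      rw [hloc i v v' hv] at hS'
      exact ⟨v', l', r', hS', by rw [add_mul, one_mul]; omega⟩
  obtain ⟨v, l, r, hS, hlr⟩ := key d le_rfl
  obtain ⟨h, v', h', hv⟩ := hS.close (hsymm d v) (by omega) (by omega)
  exact ⟨v, v', h, h', hv⟩

end Merging

/-! ### The arc language is not definable -/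

section Undefinability

variable {D : Type u} {A : Type v}

open Classical in
/-- The pairs of positions compared by `ψ` at levels below `j`, made symmetric. -/
noncomputable def comparedPairs (a : A) (ψ : Formula A 0 0) (n j : ℕ) (v : ℕ → D) :
    Finset (ℕ × ℕ) :=
  let P := (Finset.univ.filter fun p : Fin n × Fin n =>
    ψ.Compares j (fun i : Fin n => (⟨v i, a⟩ : Letter D A)) p.1 p.2)
  P.image (fun p => ((p.1 : ℕ), (p.2 : ℕ))) ∪ P.image (fun p => ((p.2 : ℕ), (p.1 : ℕ)))

theorem mem_comparedPairs {a : A} {ψ : Formula A 0 0} {n j : ℕ} {v : ℕ → D} {p q : ℕ} :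
    (p, q) ∈ comparedPairs a ψ n j v ↔ ∃ y z : Fin n,
      ψ.Compares j (fun i : Fin n => (⟨v i, a⟩ : Letter D A)) y z ∧
        ((y : ℕ) = p ∧ (z : ℕ) = q ∨ (z : ℕ) = p ∧ (y : ℕ) = q) := by
  simp only [comparedPairs, Finset.mem_union, Finset.mem_image, Finset.mem_filter,
    Finset.mem_univ, true_and, Prod.exists, Prod.mk.injEq]
  constructor
  · rintro (⟨y, z, h, h'⟩ | ⟨y, z, h, h'⟩)
    exacts [⟨y, z, h, Or.inl h'⟩, ⟨y, z, h, Or.inr h'⟩]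
  · rintro ⟨y, z, h, h' | h'⟩
    exacts [Or.inl ⟨y, z, h, h'⟩, Or.inr ⟨y, z, h, h'⟩]

theorem map_range_mem_arcLanguage_iff (a : A) (n : ℕ) (v : ℕ → D) :
    (List.range n).map (fun i => (⟨v i, a⟩ : Letter D A)) ∈ arcLanguage D A ↔
      arcRun v none 0 n = none := by
  rw [mem_arcLanguage_iff, arcRun, List.Ico.zero_bot, List.map_map]
  rfl

theorem sat_map_range_iff (a : A) (n : ℕ) (v : ℕ → D) (ψ : Formula A 0 0) :
    ψ.Sat ((List.range n).map fun i => (⟨v i, a⟩ : Letter D A)) ![] ![] ↔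
      ψ.SatOn (fun i : Fin n => (⟨v i, a⟩ : Letter D A)) ![] ![] :=
  Formula.sat_iff_satOn _ (by simp) _ (fun i => by simp) ψ

theorem not_definableSemiRigid_arcLanguage [Infinite D] [Nonempty A] :
    ¬ DefinableSemiRigid (arcLanguage D A) := by
  rintro ⟨ψ, hψ, hL⟩
  obtain ⟨a⟩ := ‹Nonempty A›
  -- The factor `2` pays for making the compared pairs symmetric.
  obtain ⟨n, hn⟩ := exists_arcRun_ne_none_and_eq_none (D := D) (2 * ψ.guards.length) ψ.testDepth
  have hcompares : ∀ (j : ℕ) (v v' : ℕ → D),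
      (∀ p q, (p, q) ∈ comparedPairs a ψ n j v → (v p = v q ↔ v' p = v' q)) →
      ∀ y z : Fin n, ψ.Compares j (fun i : Fin n => (⟨v i, a⟩ : Letter D A)) y z →
        (v y = v z ↔ v' y = v' z) :=
    fun j v v' h y z hyz => h _ _ (mem_comparedPairs.2 ⟨y, z, hyz, Or.inl ⟨rfl, rfl⟩⟩)
  have hempty (v : ℕ → D) : comparedPairs a ψ n 0 v = ∅ := by
    refine Finset.eq_empty_of_forall_notMem fun ⟨p, q⟩ hpq => ?_
    obtain ⟨y, z, ⟨g, -, hg, -⟩, -⟩ := mem_comparedPairs.1 hpq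
    exact Nat.not_lt_zero _ hg
  have hsymm (j : ℕ) (v : ℕ → D) (p q : ℕ) (h : (p, q) ∈ comparedPairs a ψ n j v) :
      (q, p) ∈ comparedPairs a ψ n j v := by
    obtain ⟨y, z, hc, h'⟩ := mem_comparedPairs.1 h
    exact mem_comparedPairs.2 ⟨y, z, hc, h'.symm.imp And.symm And.symm⟩
  have hcard (j : ℕ) (v : ℕ → D) :
      (comparedPairs a ψ n j v).card ≤ 2 * ψ.guards.length * n := by
    have hc := Formula.card_compares_le hψ j (fun i : Fin n => (⟨v i, a⟩ : Letter D A))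
    refine (Finset.card_union_le _ _).trans
      ((add_le_add Finset.card_image_le Finset.card_image_le).trans ?_)
    rw [mul_assoc, two_mul]
    exact add_le_add hc hc
  have hlocal (j : ℕ) (v v' : ℕ → D)
      (h : ∀ p q, (p, q) ∈ comparedPairs a ψ n j v → (v p = v q ↔ v' p = v' q)) :
      comparedPairs a ψ n (j + 1) v = comparedPairs a ψ n (j + 1) v' := by
    ext ⟨p, q⟩
    rw [mem_comparedPairs, mem_comparedPairs]
    refine exists_congr fun y => exists_congr fun z => and_congr_left fun _ => ?_
    exact Formula.compares_succ_congr (W := fun i : Fin n => (⟨v i, a⟩ : Letter D A))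
      (W' := fun i : Fin n => (⟨v' i, a⟩ : Letter D A)) (fun _ => rfl) (hcompares j v v' h) y z
  obtain ⟨v, v', hv, hv', h⟩ := hn (comparedPairs a ψ n) hempty hsymm hcard hlocal
  refine hv ((map_range_mem_arcLanguage_iff a n v).1 ((hL _).2 ?_))
  have h' := (hL _).1 ((map_range_mem_arcLanguage_iff a n v').2 hv')
  rw [sat_map_range_iff] at h' ⊢
  exact (Formula.satOn_congr (W := fun i : Fin n => (⟨v i, a⟩ : Letter D A))
    (W' := fun i : Fin n => (⟨v' i, a⟩ : Letter D A)) (fun _ => rfl) le_rfl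
    (hcompares _ v v' h) _ _).2 h'

end Undefinability

end DataLogic

theorem mainTheorem6 (D : Type*) [Infinite D] (A : Type*) [Finite A] [Nonempty A] :
    (∃ M : DataLogic.FMA D (DataLogic.Letter D A),
      M.IsDeterministic ∧ M.language = DataLogic.arcLanguage D A) ∧
    ¬ DataLogic.DefinableSemiRigid (DataLogic.arcLanguage D A) :=
  ⟨⟨DataLogic.arcFMA D A, DataLogic.arcFMA_isDeterministic, DataLogic.arcFMA_language⟩,
    DataLogic.not_definableSemiRigid_arcLanguage⟩
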